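/- All graphs are finite, simple and non-empty. For a graph $G$, let $\alpha(G)$ be the maximum size of an independent set of vertices of $G$, and let the girth of $G$ be the length of a shortest cycle of $G$ (infinite if $G$ has no cycle). For a positive integer $g$, let $i(3,g)$ denote the infimum of the independence ratio $\frac{\alpha(G)}{|V(G)|}$ over all cubic (that is, $3$-regular) graphs $G$ of girth at least $g$ (such graphs exist for every $g$), and let $i(3,\infty) := \lim_{g\to\infty} i(3,g)$. Then this limit exists and $$i(3,\infty) \le 0.454.$$ -/

import Mathlib

open Filter Topology

/-- The independence ratio `α(G) / |V(G)|` of a finite simple graph on `n` labelled vertices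
(every finite graph is isomorphic to one of this form). -/
noncomputable def indepRatio {n : ℕ} (G : SimpleGraph (Fin n)) : ℝ :=
  (G.indepNum : ℝ) / (n : ℝ)

open Classical in
/-- The set of the independence ratios of all non-empty finite simple `r`-regular graphs of girth
at least `g`. The extended girth is the length of a shortest cycle, and `⊤` if there is none. -/
def regularGirthRatios (r g : ℕ) : Set ℝ :=
  {ρ | ∃ (n : ℕ) (G : SimpleGraph (Fin n)),
    0 < n ∧ G.IsRegularOfDegree r ∧ (g : ℕ∞) ≤ G.egirth ∧ ρ = indepRatio G}

/-- `i(r, g)`: the infimum of the independence ratio over the `r`-regular graphs of girth at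
least `g`. -/
noncomputable def infIndepRatio (r g : ℕ) : ℝ :=
  sInf (regularGirthRatios r g)

/-! The proof interpolates between a random cubic graph and a system of independent vertices; this
is the upper bound of one-step replica symmetry breaking. Suppose that every cubic graph on `n`
vertices without short cycles has independence number above `0.454 n`. Build such graphs by joining
far-apart free half-edges and weigh each partial graph by `lam` to the power of its independence
number. Instead of being joined, a half-edge may be discarded, deleting its vertex with probability
`q`.

Put `c = 1 - lam⁻¹` and let `x` be the weighted mean fraction of free half-edges at frozen vertices.
Relative to the number of choices, a join multiplies the total weight by at most `1 - c x²` and a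
discard by at least `1 - c q x`. Since `(1 - c q x)² - (1 - c x²)(1 - c q²) = c (q - x)²`, discards
control joins whatever `x` is: this is `partition_mul_partition_le`.

In logarithms this is an averaging inequality for `freeEnergy` on the grid of numbers of joins and
discards. Without discards, the assumption bounds the free energy from below, because a partial
graph can be completed to a cubic one at a cost of half its missing half-edges
(`LocallyFar.exists_cubic`). Without joins, the weight factorises over the vertices, which gives an
upper bound (`partition_zero_le`). The comparison principle `quadratic_le_of_average_le` carries the
lower bound from one axis of the grid to the other. Its quadratic term deals with the frontier where
too few half-edges are left for far pairs to dominate, at a cost independent of `n`.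

Up to small errors, the outcome is that `0.454 * log lam` is at most `log (1 + (lam - 1)(1 - q)³) -
(3/2) log (1 - c q²)`. For `lam = 8` and `q = 3/5` this is false, because the right side is at most
`(19/42) log 8` (`replica_bound_numeric`) and `19/42 < 0.4524`. -/

/-- Every walk of `G` from `a` to `b` has length at least `m`. -/
def FarApart {V : Type*} (m : ℕ) (G : SimpleGraph V) (a b : V) : Prop :=
  ∀ w : G.Walk a b, m ≤ w.length

/-- The ends of each edge stay at distance at least `m` when that edge is removed, so that every
cycle is longer than `m`. -/
def LocallyFar {V : Type*} (m : ℕ) (G : SimpleGraph V) : Prop :=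
  ∀ a b, G.Adj a b → FarApart m (G.deleteEdges {s(a, b)}) a b

/-- The number of neighbours of `i`. -/
noncomputable def valency {V : Type*} (G : SimpleGraph V) (i : V) : ℕ := (G.neighborSet i).ncard

/-! ### Walks, girth and the addition of an edge -/

section Walks

variable {V : Type*} {m : ℕ} {G H : SimpleGraph V} {a b u v : V}

theorem FarApart.symm (h : FarApart m G a b) : FarApart m G b a := fun w => by
  simpa using h w.reverse

theorem FarApart.anti (hGH : G ≤ H) (h : FarApart m H a b) : FarApart m G a b := fun w => by
  simpa using h (w.mapLe hGH)

theorem FarApart.ne (hm : 1 ≤ m) (h : FarApart m G a b) : a ≠ b := by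
  rintro rfl
  have := h SimpleGraph.Walk.nil
  simp at this
  omega

theorem FarApart.not_adj (hm : 2 ≤ m) (h : FarApart m G a b) : ¬ G.Adj a b := fun hab => by
  have := h (SimpleGraph.Walk.cons hab SimpleGraph.Walk.nil)
  simp at this
  omega

theorem LocallyFar.anti (hGH : G ≤ H) (h : LocallyFar m H) : LocallyFar m G := fun a b hab =>
  (h a b (hGH hab)).anti (SimpleGraph.deleteEdges_mono hGH)

theorem locallyFar_bot : LocallyFar m (⊥ : SimpleGraph V) := fun a b hab => by simp at hab

/-- A walk using an additional edge can be shortened to one using it at most once. -/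
theorem exists_walk_of_walk_sup_edge (w : (G ⊔ SimpleGraph.edge a b).Walk u v) :
    (∃ p : G.Walk u v, p.length ≤ w.length) ∨
    (∃ (p : G.Walk u a) (q : G.Walk b v), p.length + q.length + 1 ≤ w.length) ∨
    (∃ (p : G.Walk u b) (q : G.Walk a v), p.length + q.length + 1 ≤ w.length) := by
  induction w with
  | nil => exact Or.inl ⟨SimpleGraph.Walk.nil, by simp⟩
  | @cons u u' v h w ih =>
    rw [SimpleGraph.sup_adj, SimpleGraph.edge_adj] at h
    simp only [SimpleGraph.Walk.length_cons]
    rcases h with h | ⟨⟨rfl, rfl⟩ | ⟨rfl, rfl⟩, -⟩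
    · rcases ih with ⟨p, hp⟩ | ⟨p, q, hp⟩ | ⟨p, q, hp⟩
      · exact Or.inl ⟨SimpleGraph.Walk.cons h p, by simpa using hp⟩
      · exact Or.inr (Or.inl ⟨SimpleGraph.Walk.cons h p, q, by
          simp only [SimpleGraph.Walk.length_cons]; omega⟩)
      · exact Or.inr (Or.inr ⟨SimpleGraph.Walk.cons h p, q, by
          simp only [SimpleGraph.Walk.length_cons]; omega⟩)
    · rcases ih with ⟨p, hp⟩ | ⟨p, q, hp⟩ | ⟨p, q, hp⟩
      · exact Or.inr (Or.inl ⟨SimpleGraph.Walk.nil, p, by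
          simp only [SimpleGraph.Walk.length_nil]; omega⟩)
      · exact Or.inr (Or.inl ⟨SimpleGraph.Walk.nil, q, by
          simp only [SimpleGraph.Walk.length_nil]; omega⟩)
      · exact Or.inl ⟨q, by omega⟩
    · rcases ih with ⟨p, hp⟩ | ⟨p, q, hp⟩ | ⟨p, q, hp⟩
      · exact Or.inr (Or.inr ⟨SimpleGraph.Walk.nil, p, by
          simp only [SimpleGraph.Walk.length_nil]; omega⟩)
      · exact Or.inl ⟨q, by omega⟩
      · exact Or.inr (Or.inr ⟨SimpleGraph.Walk.nil, q, by
          simp only [SimpleGraph.Walk.length_nil]; omega⟩)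

/-- A walk from `u` to `v` that avoids the old edge `uv` but crosses `ab` once closes up, through
`uv`, to a walk of `G` from `a` to `b` of no greater length. -/
theorem LocallyFar.sup_edge (hG : LocallyFar m G) (hab : FarApart m G a b) :
    LocallyFar m (G ⊔ SimpleGraph.edge a b) := by
  intro u v huv w
  by_cases h : G.Adj u v
  · have hle : (G ⊔ SimpleGraph.edge a b).deleteEdges {s(u, v)} ≤
        G.deleteEdges {s(u, v)} ⊔ SimpleGraph.edge a b := by
      intro x y
      simp only [SimpleGraph.deleteEdges_adj, SimpleGraph.sup_adj]
      tauto
    have hle' : G.deleteEdges {s(u, v)} ≤ G := SimpleGraph.deleteEdges_le _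
    have hlen : (w.mapLe hle).length = w.length := by simp
    rcases exists_walk_of_walk_sup_edge (w.mapLe hle) with ⟨p, hp⟩ | ⟨p, q, hp⟩ | ⟨p, q, hp⟩
    · exact (hG u v h p).trans (hp.trans hlen.le)
    · have := hab (((p.mapLe hle').reverse).append (SimpleGraph.Walk.cons h (q.mapLe hle').reverse))
      simp at this
      omega
    · have := hab ((q.mapLe hle').append
        (SimpleGraph.Walk.cons h.symm (p.mapLe hle')))
      simp at this
      omega
  · have hs : (u = a ∧ v = b) ∨ (u = b ∧ v = a) := by
      rw [SimpleGraph.sup_adj, SimpleGraph.edge_adj] at huv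
      tauto
    have hle : (G ⊔ SimpleGraph.edge a b).deleteEdges {s(u, v)} ≤ G := by
      intro x y
      simp only [SimpleGraph.deleteEdges_adj, SimpleGraph.sup_adj, SimpleGraph.edge_adj,
        Set.mem_singleton_iff, Sym2.eq_iff]
      rcases hs with ⟨rfl, rfl⟩ | ⟨rfl, rfl⟩ <;> tauto
    rcases hs with ⟨rfl, rfl⟩ | ⟨rfl, rfl⟩
    · exact hab.anti hle w
    · exact hab.symm.anti hle w

theorem LocallyFar.le_egirth (hG : LocallyFar m G) : (m : ℕ∞) ≤ G.egirth := by
  rw [SimpleGraph.le_egirth]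
  intro a w hw
  cases w with
  | nil => simp at hw
  | @cons _ b _ h p =>
    rw [SimpleGraph.Walk.cons_isCycle_iff] at hw
    have := hG a b h ((p.toDeleteEdge s(a, b) hw.2).reverse)
    simp [SimpleGraph.Walk.toDeleteEdge] at this
    simp only [SimpleGraph.Walk.length_cons]
    exact_mod_cast this.trans (Nat.le_succ _)

end Walks

/-! ### Completing subcubic graphs to cubic ones by switchings -/

section Switching

variable {V : Type*} {m : ℕ} {G : SimpleGraph V} {u v x y : V}

theorem deleteEdges_sup_edge (h : G.Adj x y) :
    G.deleteEdges {s(x, y)} ⊔ SimpleGraph.edge x y = G := by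
  ext p q
  simp only [SimpleGraph.deleteEdges_adj, SimpleGraph.sup_adj, SimpleGraph.edge_adj,
    Set.mem_singleton_iff, Sym2.eq_iff]
  constructor
  · rintro (h1 | ⟨⟨rfl, rfl⟩ | ⟨rfl, rfl⟩, -⟩)
    exacts [h1.1, h, h.symm]
  · intro h1
    have := h1.ne
    tauto

/-- Replacing an edge `xy` far from `u` and `v` by `ux` and `vy` creates no short cycle. -/
theorem LocallyFar.farApart_switch (hG : LocallyFar m G) (hxy : G.Adj x y) (hvx : FarApart m G v x)
    (hvy : FarApart m G v y) :
    FarApart m (G.deleteEdges {s(x, y)} ⊔ SimpleGraph.edge u x) v y := by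
  intro w
  have hle : G.deleteEdges {s(x, y)} ≤ G := SimpleGraph.deleteEdges_le _
  -- A walk crossing `ux` towards `x` goes on from `x` to `y` without the edge `xy`, which is long
  -- by `hG`; one crossing towards `u` has first gone from `v` to `x`.
  rcases exists_walk_of_walk_sup_edge w with ⟨p, hp⟩ | ⟨p, q, hp⟩ | ⟨p, q, hp⟩
  · exact (hvy.anti hle p).trans hp
  · have := hG x y hxy q
    omega
  · have := hvx.anti hle p
    omega

theorem valency_sup_edge [Finite V] {i : V} [DecidableEq V] (hne : x ≠ y) (hn : ¬ G.Adj x y) :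
    valency (G ⊔ SimpleGraph.edge x y) i =
      valency G i + (if i = x then 1 else 0) + (if i = y then 1 else 0) := by
  unfold valency
  by_cases hx : i = x
  · subst hx
    have : (G ⊔ SimpleGraph.edge i y).neighborSet i = insert y (G.neighborSet i) := by
      ext j
      simp only [SimpleGraph.mem_neighborSet, SimpleGraph.sup_adj, SimpleGraph.edge_adj,
        Set.mem_insert_iff]
      grind
    rw [this, Set.ncard_insert_of_notMem (by simpa using hn)]
    simp [hne]
  · by_cases hy : i = y
    · subst hy
      have : (G ⊔ SimpleGraph.edge x i).neighborSet i = insert x (G.neighborSet i) := by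
        ext j
        simp only [SimpleGraph.mem_neighborSet, SimpleGraph.sup_adj, SimpleGraph.edge_adj,
          Set.mem_insert_iff]
        grind
      rw [this, Set.ncard_insert_of_notMem (by simpa [SimpleGraph.adj_comm] using hn)]
      simp [hx]
    · have : (G ⊔ SimpleGraph.edge x y).neighborSet i = G.neighborSet i := by
        ext j
        simp only [SimpleGraph.mem_neighborSet, SimpleGraph.sup_adj, SimpleGraph.edge_adj]
        tauto
      simp [this, hx, hy]

theorem even_sum_valency [Fintype V] : Even (∑ i, valency G i) := by
  classical
  have h : ∀ i, valency G i = G.degree i := fun i => by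
    rw [valency, Set.ncard_eq_toFinset_card', ← SimpleGraph.card_neighborFinset_eq_degree]
    rfl
  simp only [h, SimpleGraph.sum_degrees_eq_twice_card_edges]
  exact even_two_mul _

/-- In a graph with valencies at most three only boundedly many vertices are near a given one. -/
theorem exists_near_finset [Fintype V] (hG : ∀ i, valency G i ≤ 3) (u : V) (m : ℕ) :
    ∃ Z : Finset V, Z.card ≤ 4 ^ m ∧ ∀ z, ∀ w : G.Walk u z, w.length ≤ m → z ∈ Z := by
  classical
  induction m with
  | zero =>
    refine ⟨{u}, by simp, fun z w hw => ?_⟩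
    have := w.eq_of_length_eq_zero (by omega)
    simp [this]
  | succ m ih =>
    obtain ⟨Z, hZ, hZ'⟩ := ih
    refine ⟨Z ∪ Z.biUnion fun z => G.neighborFinset z, ?_, ?_⟩
    · have h1 : (Z.biUnion fun z => G.neighborFinset z).card ≤ Z.card * 3 := by
        refine Finset.card_biUnion_le_card_mul _ _ _ fun z _ => ?_
        have := hG z
        rwa [valency, Set.ncard_eq_toFinset_card'] at this
      have := Finset.card_union_le Z (Z.biUnion fun z => G.neighborFinset z)
      rw [pow_succ]
      omega
    · intro z w hw
      obtain h0 | h0 := Nat.eq_zero_or_pos w.length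
      · exact Finset.mem_union_left _ (hZ' z w (by omega))
      · have hnil : ¬ w.Nil := by
          rw [← SimpleGraph.Walk.length_eq_zero_iff]; omega
        have hp := hZ' w.penultimate w.dropLast (by
          rw [SimpleGraph.Walk.length_dropLast]; omega)
        refine Finset.mem_union_right _ (Finset.mem_biUnion.2 ⟨_, hp, ?_⟩)
        simpa using w.adj_penultimate hnil

theorem indepNum_anti [Finite V] {H : SimpleGraph V} (h : G ≤ H) : H.indepNum ≤ G.indepNum := by
  obtain ⟨s, hs⟩ := H.exists_isNIndepSet_indepNum
  rw [← hs.card_eq]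
  exact SimpleGraph.IsIndepSet.card_le_indepNum
    (fun a ha b hb hab hadj => hs.isIndepSet ha hb hab (h hadj))

theorem indepNum_deleteEdges_le [Finite V] :
    (G.deleteEdges {s(x, y)}).indepNum ≤ G.indepNum + 1 := by
  classical
  obtain ⟨s, hs⟩ := (G.deleteEdges {s(x, y)}).exists_isNIndepSet_indepNum
  have h1 : G.IsIndepSet (s.erase x : Finset V) := by
    intro a ha b hb hab hadj
    simp only [Finset.coe_erase, Set.mem_sdiff, Finset.mem_coe, Set.mem_singleton_iff] at ha hb
    refine hs.isIndepSet ha.1 hb.1 hab ?_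
    rw [SimpleGraph.deleteEdges_adj]
    refine ⟨hadj, ?_⟩
    simp only [Set.mem_singleton_iff, Sym2.eq_iff]
    tauto
  have h2 := SimpleGraph.IsIndepSet.card_le_indepNum h1
  have h3 := Finset.pred_card_le_card_erase (s := s) (a := x)
  rw [hs.card_eq] at h3
  omega

/-- A subcubic graph without short cycles that is not cubic can be given one more edge by a
switching, if it is large enough. -/
theorem LocallyFar.exists_switch [Fintype V] [DecidableEq V] (hm : 2 ≤ m)
    (hV : 2 * 4 ^ (m + 1) < Fintype.card V) (hG : LocallyFar m G)
    (hG3 : ∀ i, valency G i ≤ 3)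
    (huv : ∀ i, valency G i + (if i = u then 1 else 0) + (if i = v then 1 else 0) ≤ 3) :
    ∃ H : SimpleGraph V, LocallyFar m H ∧ (∀ i, valency H i ≤ 3) ∧
      (∑ i, valency H i = ∑ i, valency G i + 2) ∧ H.indepNum ≤ G.indepNum + 1 := by
  have sum_ind : ∀ p : V, (∑ i : V, if i = p then 1 else 0) = 1 := fun p => by simp
  -- The radius leaves room for one more step, so that a neighbour `y` of `x` is far from `u` and
  -- `v` as well.
  obtain ⟨Zu, hZu, hu⟩ := exists_near_finset hG3 u (m + 1)
  obtain ⟨Zv, hZv, hv⟩ := exists_near_finset hG3 v (m + 1)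
  obtain ⟨x, hx⟩ : ∃ x, x ∉ Zu ∪ Zv := by
    by_contra! h
    have h1 := Finset.card_le_card (fun x _ => h x : Finset.univ ⊆ Zu ∪ Zv)
    have h2 := Finset.card_union_le Zu Zv
    rw [Finset.card_univ] at h1
    omega
  simp only [Finset.mem_union, not_or] at hx
  have hux : FarApart m G u x := fun w => by
    by_contra! h
    exact hx.1 (hu x w (by omega))
  have hvx : FarApart m G v x := fun w => by
    by_contra! h
    exact hx.2 (hv x w (by omega))
  by_cases hxy : ∃ y, G.Adj x y
  · obtain ⟨y, hxy⟩ := hxy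
    have huy : FarApart m G u y := fun w => by
      by_contra! h
      exact hx.1 (hu x (w.append (SimpleGraph.Walk.cons hxy.symm SimpleGraph.Walk.nil)) (by
        simp; omega))
    have hvy : FarApart m G v y := fun w => by
      by_contra! h
      exact hx.2 (hv x (w.append (SimpleGraph.Walk.cons hxy.symm SimpleGraph.Walk.nil)) (by
        simp; omega))
    have hle : G.deleteEdges {s(x, y)} ≤ G := SimpleGraph.deleteEdges_le _
    have h1 : FarApart m (G.deleteEdges {s(x, y)}) u x := hux.anti hle
    have h2 : FarApart m (G.deleteEdges {s(x, y)} ⊔ SimpleGraph.edge u x) v y :=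
      hG.farApart_switch hxy hvx hvy
    have hval : ∀ i, valency (G.deleteEdges {s(x, y)} ⊔ SimpleGraph.edge u x ⊔
        SimpleGraph.edge v y) i =
        valency G i + (if i = u then 1 else 0) + (if i = v then 1 else 0) := fun i => by
      rw [valency_sup_edge (h2.ne (by omega)) (h2.not_adj hm),
        valency_sup_edge (h1.ne (by omega)) (h1.not_adj hm)]
      conv_rhs => rw [← deleteEdges_sup_edge hxy, valency_sup_edge hxy.ne (by simp)]
      ring
    refine ⟨_, ((hG.anti hle).sup_edge h1).sup_edge h2, fun i => (hval i).trans_le (huv i), ?_, ?_⟩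
    · simp only [hval, Finset.sum_add_distrib, sum_ind]
    · exact (indepNum_anti (le_sup_left.trans le_sup_left)).trans indepNum_deleteEdges_le
  -- When `x` is isolated nothing has to be removed: the single edge `ux` already adds two to the
  -- sum of the valencies.
  · have hx0 : valency G x = 0 := by
      have : G.neighborSet x = ∅ := by
        ext y
        simp only [SimpleGraph.mem_neighborSet, Set.mem_empty_iff_false, iff_false]
        exact fun h => hxy ⟨y, h⟩
      rw [valency, this, Set.ncard_empty]
    have hval : ∀ i, valency (G ⊔ SimpleGraph.edge u x) i =
        valency G i + (if i = u then 1 else 0) + (if i = x then 1 else 0) := fun i =>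
      valency_sup_edge (hux.ne (by omega)) (hux.not_adj hm)
    refine ⟨_, hG.sup_edge hux, fun i => ?_, ?_, ?_⟩
    · rw [hval]
      by_cases hi : i = x
      · subst hi
        rw [hx0]
        split_ifs <;> omega
      · have := huv i
        rw [if_neg hi]
        omega
    · simp only [hval, Finset.sum_add_distrib, sum_ind]
    · exact (indepNum_anti le_sup_left).trans (Nat.le_succ _)

/-- A large subcubic graph without short cycles, on an even number of vertices, can be completed to
a cubic one at the price of half the number of missing half-edges. -/
theorem LocallyFar.exists_cubic [Fintype V] (hm : 2 ≤ m)
    (hV : 2 * 4 ^ (m + 1) < Fintype.card V) (heven : Even (Fintype.card V)) (d : ℕ)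
    (hG : LocallyFar m G) (hG3 : ∀ i, valency G i ≤ 3)
    (hd : 3 * Fintype.card V ≤ ∑ i, valency G i + d) :
    ∃ H : SimpleGraph V, LocallyFar m H ∧ (∀ i, valency H i = 3) ∧
      2 * H.indepNum ≤ 2 * G.indepNum + d := by
  classical
  induction d using Nat.strong_induction_on generalizing G with
  | _ d ih =>
  by_cases hreg : ∀ i, valency G i = 3
  · exact ⟨G, hG, hreg, by omega⟩
  · push Not at hreg
    obtain ⟨u, hu⟩ := hreg
    have hu3 := hG3 u
    have hV3 : ∑ _i : V, 3 = 3 * Fintype.card V := by simp [mul_comm]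
    -- Both sides of the strict inequality are even, so at least two half-edges are missing.
    have hpar : ∑ i, valency G i + 2 ≤ 3 * Fintype.card V := by
      have h1 : ∑ i, valency G i < 3 * Fintype.card V := by
        rw [← hV3]
        exact Finset.sum_lt_sum (fun i _ => hG3 i) ⟨u, Finset.mem_univ _, by omega⟩
      obtain ⟨p, hp⟩ := even_sum_valency (G := G)
      obtain ⟨q, hq⟩ := heven
      omega
    -- The second missing half-edge may be at `u` itself; hence the choice `v = u` when `u` lacks
    -- two.
    obtain ⟨v, huv⟩ : ∃ v, ∀ i,
        valency G i + (if i = u then 1 else 0) + (if i = v then 1 else 0) ≤ 3 := by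
      by_cases hu1 : valency G u ≤ 1
      · refine ⟨u, fun i => ?_⟩
        have := hG3 i
        by_cases hi : i = u
        · subst hi; simp; omega
        · simp [hi]; omega
      · obtain ⟨v, hv⟩ : ∃ v, valency G v + (if v = u then 1 else 0) < 3 := by
          by_contra! hcon
          have := Finset.sum_le_sum (fun i (_ : i ∈ Finset.univ) => hcon i)
          rw [hV3, Finset.sum_add_distrib] at this
          simp at this
          omega
        refine ⟨v, fun i => ?_⟩
        have h3 := hG3 i
        by_cases hi : i = v
        · subst hi; simp; omega
        · simp only [hi, if_false]
          split_ifs with h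
          · subst h; omega
          · omega
    obtain ⟨H, hH, hH3, hsum, hind⟩ := hG.exists_switch hm hV hG3 huv
    have hd2 : 2 ≤ d := by omega
    obtain ⟨K, hK, hK3, hKi⟩ := ih (d - 2) (by omega) hH hH3 (by omega)
    exact ⟨K, hK, hK3, by omega⟩

end Switching

theorem indepRatio_mem_regularGirthRatios {m n : ℕ} (hn : 0 < n) {G : SimpleGraph (Fin n)}
    (hG : LocallyFar m G) (h3 : ∀ i, valency G i = 3) : indepRatio G ∈ regularGirthRatios 3 m := by
  refine ⟨n, G, hn, fun i => ?_, hG.le_egirth, rfl⟩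
  classical
  rw [← h3 i, valency, Set.ncard_eq_toFinset_card', ← SimpleGraph.card_neighborFinset_eq_degree]
  unfold SimpleGraph.neighborFinset
  congr!

/-! ### Building steps as operators on functions of the state -/

/-- A partially built cubic graph on `n` vertices, each with three half-edges: the graph built so
far, the half-edges that are still free, and the vertices that have been deleted. -/
structure PartialCubic (n : ℕ) where
  /-- the graph built so far -/
  graph : SimpleGraph (Fin n)
  /-- the free half-edges -/
  free : Finset (Fin n × Fin 3)
  /-- the deleted vertices -/
  deleted : Finset (Fin n)

namespace PartialCubic

variable {n : ℕ}

/-- Join two half-edges by an edge. -/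
def join (σ : PartialCubic n) (u v : Fin n × Fin 3) : PartialCubic n :=
  ⟨σ.graph ⊔ SimpleGraph.edge u.1 v.1, (σ.free.erase u).erase v, σ.deleted⟩

/-- Use up a half-edge. -/
def use (σ : PartialCubic n) (u : Fin n × Fin 3) : PartialCubic n :=
  ⟨σ.graph, σ.free.erase u, σ.deleted⟩

/-- Use up a half-edge and delete its vertex. -/
def kill (σ : PartialCubic n) (u : Fin n × Fin 3) : PartialCubic n :=
  ⟨σ.graph, σ.free.erase u, insert u.1 σ.deleted⟩

open Classical in
/-- Sum over all ways of joining two free half-edges whose vertices are far apart. -/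
noncomputable def joinOp (n m : ℕ) : Module.End ℝ (PartialCubic n → ℝ) where
  toFun f σ := ∑ u ∈ σ.free, ∑ v ∈ σ.free.erase u,
    if FarApart m σ.graph u.1 v.1 then f (σ.join u v) else 0
  map_add' f g := by
    funext σ
    simp only [Pi.add_apply, ← Finset.sum_add_distrib]
    refine Finset.sum_congr rfl fun u _ => Finset.sum_congr rfl fun v _ => ?_
    split_ifs <;> simp
  map_smul' c f := by
    funext σ
    simp only [Pi.smul_apply, smul_eq_mul, Finset.mul_sum, RingHom.id_apply, mul_ite, mul_zero]

/-- Sum over the free half-edges, each of which is used up and deletes its vertex with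
probability `q`. -/
noncomputable def warnOp (n : ℕ) (q : ℝ) : Module.End ℝ (PartialCubic n → ℝ) where
  toFun f σ := ∑ u ∈ σ.free, ((1 - q) * f (σ.use u) + q * f (σ.kill u))
  map_add' f g := by
    funext σ
    simp only [Pi.add_apply, ← Finset.sum_add_distrib]
    exact Finset.sum_congr rfl fun u _ => by ring
  map_smul' c f := by
    funext σ
    simp only [Pi.smul_apply, smul_eq_mul, Finset.mul_sum, RingHom.id_apply]
    exact Finset.sum_congr rfl fun u _ => by ring

open Classical in
theorem joinOp_apply {m : ℕ} (f : PartialCubic n → ℝ) (σ : PartialCubic n) :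
    joinOp n m f σ = ∑ u ∈ σ.free, ∑ v ∈ σ.free.erase u,
      if FarApart m σ.graph u.1 v.1 then f (σ.join u v) else 0 := rfl

theorem warnOp_apply {q : ℝ} (f : PartialCubic n → ℝ) (σ : PartialCubic n) :
    warnOp n q f σ = ∑ u ∈ σ.free, ((1 - q) * f (σ.use u) + q * f (σ.kill u)) := rfl

theorem _root_.Finset.sum_sum_erase_comm {α M : Type*} [DecidableEq α] [AddCommMonoid M]
    (s : Finset α) (F : α → α → M) :
    ∑ u ∈ s, ∑ w ∈ s.erase u, F u w = ∑ w ∈ s, ∑ u ∈ s.erase w, F u w :=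
  Finset.sum_comm' fun u w => by simp only [Finset.mem_erase]; tauto

/-- Discarding a half-edge leaves the graph, and hence the distance test, unchanged, and joining
leaves the deleted set unchanged. Commutation allows a step of either kind to be treated as the last
one, which is what makes joins and discards comparable. -/
theorem commute_joinOp_warnOp (m : ℕ) (q : ℝ) : Commute (joinOp n m) (warnOp n q) := by
  classical
  refine LinearMap.ext fun f => funext fun σ => ?_
  simp only [Module.End.mul_apply]
  rw [joinOp_apply, warnOp_apply]
  simp only [warnOp_apply, joinOp_apply]
  have key : ∀ u v w : Fin n × Fin 3,
      (σ.join u v).use w = (σ.use w).join u v ∧ (σ.join u v).kill w = (σ.kill w).join u v := by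
    intro u v w
    simp only [join, use, kill, mk.injEq, true_and, and_true]
    constructor
    all_goals rw [Finset.erase_right_comm (s := σ.free.erase u), Finset.erase_right_comm (s := σ.free)]
  have h1 : ∀ u ∈ σ.free, (∑ v ∈ σ.free.erase u, if FarApart m σ.graph u.1 v.1 then
      ∑ w ∈ (σ.join u v).free, ((1 - q) * f ((σ.join u v).use w) + q * f ((σ.join u v).kill w))
      else 0) = ∑ w ∈ σ.free.erase u, ∑ v ∈ (σ.free.erase u).erase w,
        if FarApart m σ.graph u.1 v.1 then
          ((1 - q) * f ((σ.use w).join u v) + q * f ((σ.kill w).join u v)) else 0 := by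
    intro u _
    rw [← Finset.sum_sum_erase_comm]
    refine Finset.sum_congr rfl fun v _ => ?_
    split_ifs
    · exact Finset.sum_congr rfl fun w _ => by rw [(key u v w).1, (key u v w).2]
    · simp
  rw [Finset.sum_congr rfl h1, Finset.sum_sum_erase_comm]
  refine Finset.sum_congr rfl fun w _ => ?_
  have hfree : (σ.use w).free = σ.free.erase w ∧ (σ.kill w).free = σ.free.erase w := ⟨rfl, rfl⟩
  rw [hfree.1, hfree.2]
  simp only [Finset.mul_sum, ← Finset.sum_add_distrib]
  refine Finset.sum_congr rfl fun u _ => ?_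
  rw [Finset.erase_right_comm]
  refine Finset.sum_congr rfl fun v _ => ?_
  by_cases h : FarApart m σ.graph u.1 v.1
  · rw [if_pos h, if_pos (show FarApart m (σ.use w).graph u.1 v.1 from h),
      if_pos (show FarApart m (σ.kill w).graph u.1 v.1 from h)]
  · rw [if_neg h, if_neg (show ¬ FarApart m (σ.use w).graph u.1 v.1 from h),
      if_neg (show ¬ FarApart m (σ.kill w).graph u.1 v.1 from h)]
    simp

/-- The states that are reached from the empty graph by joining half-edges and using up `l`
of them, so that `j` remain free. -/
structure Valid (m j l : ℕ) (σ : PartialCubic n) : Prop where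
  locallyFar : LocallyFar m σ.graph
  valency_add : ∀ i, valency σ.graph i + (σ.free.filter fun u => u.1 = i).card ≤ 3
  card_free : σ.free.card = j
  card_deleted : σ.deleted.card ≤ l
  le_sum : 3 * n ≤ ∑ i, valency σ.graph i + j + l

variable {m j l : ℕ} {σ : PartialCubic n} {q : ℝ}

theorem Valid.join (hm : 2 ≤ m) (h : σ.Valid m (j + 2) l) {u v : Fin n × Fin 3} (hu : u ∈ σ.free)
    (hv : v ∈ σ.free.erase u) (huv : FarApart m σ.graph u.1 v.1) : (σ.join u v).Valid m j l := by
  have hcard : ((σ.free.erase u).erase v).card = j := by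
    rw [Finset.card_erase_of_mem hv, Finset.card_erase_of_mem hu, h.card_free]
    omega
  have hval := fun i => valency_sup_edge (i := i) (huv.ne (by omega)) (huv.not_adj hm)
  refine ⟨h.locallyFar.sup_edge huv, fun i => ?_, hcard, h.card_deleted, ?_⟩
  · have h1 := h.valency_add i
    simp only [PartialCubic.join]
    rw [hval]
    have hne : u.1 ≠ v.1 := huv.ne (by omega)
    rw [Finset.filter_erase, Finset.filter_erase]
    by_cases hiu : i = u.1
    · have hmem : u ∈ σ.free.filter fun w => w.1 = i := by simp [hu, hiu]
      have h2 := Finset.card_erase_lt_of_mem hmem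
      have h3 := Finset.card_le_card (Finset.erase_subset v ((σ.free.filter fun w => w.1 = i).erase u))
      have : i ≠ v.1 := by rw [hiu]; exact hne
      rw [if_pos hiu, if_neg this]
      omega
    · by_cases hiv : i = v.1
      · have hvu : v ≠ u := by rintro rfl; exact hne rfl
        have hmem : v ∈ (σ.free.filter fun w => w.1 = i).erase u := by
          simp [Finset.mem_of_mem_erase hv, hiv, hvu]
        have h2 := Finset.card_erase_lt_of_mem hmem
        have h3 := Finset.card_le_card (Finset.erase_subset u (σ.free.filter fun w => w.1 = i))
        rw [if_neg hiu, if_pos hiv]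
        omega
      · have h2 := Finset.card_le_card ((Finset.erase_subset v _).trans
          (Finset.erase_subset u (σ.free.filter fun w => w.1 = i)))
        rw [if_neg hiu, if_neg hiv]
        omega
  · have := h.le_sum
    simp only [PartialCubic.join, hval, Finset.sum_add_distrib]
    simp
    omega

theorem Valid.use (h : σ.Valid m (j + 1) l) {u : Fin n × Fin 3} (hu : u ∈ σ.free) :
    (σ.use u).Valid m j (l + 1) := by
  refine ⟨h.locallyFar, fun i => ?_, ?_, h.card_deleted.trans (Nat.le_succ _), ?_⟩
  · refine le_trans (Nat.add_le_add_left (Finset.card_le_card ?_) _) (h.valency_add i)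
    exact Finset.filter_subset_filter _ (Finset.erase_subset _ _)
  · simp only [PartialCubic.use]
    rw [Finset.card_erase_of_mem hu, h.card_free]
    rfl
  · have := h.le_sum
    simp only [PartialCubic.use]
    omega

theorem Valid.kill (h : σ.Valid m (j + 1) l) {u : Fin n × Fin 3} (hu : u ∈ σ.free) :
    (σ.kill u).Valid m j (l + 1) := by
  have h' := h.use hu
  exact ⟨h'.locallyFar, h'.valency_add, h'.card_free,
    (Finset.card_insert_le _ _).trans (Nat.succ_le_succ h.card_deleted), h'.le_sum⟩

theorem Valid.valency_le (h : σ.Valid m j l) (i : Fin n) : valency σ.graph i ≤ 3 :=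
  le_of_add_le_left (h.valency_add i)

/-- The state from which the construction starts. -/
def init (n : ℕ) : PartialCubic n := ⟨⊥, Finset.univ, ∅⟩

theorem card_filter_fst_eq (i : Fin n) :
    (Finset.univ.filter fun u : Fin n × Fin 3 => u.1 = i).card = 3 := by
  have : (Finset.univ.filter fun u : Fin n × Fin 3 => u.1 = i) =
      {i} ×ˢ (Finset.univ : Finset (Fin 3)) := by
    ext ⟨a, b⟩; simp [eq_comm]
  rw [this]; simp

theorem init_valid (n m : ℕ) : (init n).Valid m (3 * n) 0 := by
  have hval : ∀ i : Fin n, valency (⊥ : SimpleGraph (Fin n)) i = 0 := fun i => by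
    have : (⊥ : SimpleGraph (Fin n)).neighborSet i = ∅ := by ext; simp
    rw [valency, this, Set.ncard_empty]
  refine ⟨locallyFar_bot, fun i => ?_, ?_, by simp [init], by simp [init]⟩
  · simp only [init, hval]
    rw [card_filter_fst_eq]
  · simp [init, mul_comm]

theorem joinOp_mono (hm : 2 ≤ m) {f g : PartialCubic n → ℝ}
    (hfg : ∀ τ, τ.Valid m j l → f τ ≤ g τ) (hσ : σ.Valid m (j + 2) l) :
    joinOp n m f σ ≤ joinOp n m g σ := by
  simp only [joinOp_apply]
  refine Finset.sum_le_sum fun u hu => Finset.sum_le_sum fun v hv => ?_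
  split_ifs with h
  · exact hfg _ (hσ.join hm hu hv h)
  · exact le_rfl

theorem warnOp_mono (hq0 : 0 ≤ q) (hq1 : q ≤ 1) {f g : PartialCubic n → ℝ}
    (hfg : ∀ τ, τ.Valid m j (l + 1) → f τ ≤ g τ) (hσ : σ.Valid m (j + 1) l) :
    warnOp n q f σ ≤ warnOp n q g σ := by
  simp only [warnOp_apply]
  refine Finset.sum_le_sum fun u hu => add_le_add ?_ ?_
  · exact mul_le_mul_of_nonneg_left (hfg _ (hσ.use hu)) (by linarith)
  · exact mul_le_mul_of_nonneg_left (hfg _ (hσ.kill hu)) hq0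

theorem warnOp_pow_mono (hq0 : 0 ≤ q) (hq1 : q ≤ 1) {f g : PartialCubic n → ℝ} (b : ℕ)
    (hfg : ∀ τ, τ.Valid m j (l + b) → f τ ≤ g τ) (hσ : σ.Valid m (j + b) l) :
    (warnOp n q ^ b) f σ ≤ (warnOp n q ^ b) g σ := by
  induction b generalizing l σ with
  | zero => exact hfg σ hσ
  | succ b ih =>
    rw [pow_succ', Module.End.mul_apply, Module.End.mul_apply]
    exact warnOp_mono hq0 hq1 (fun τ hτ => ih (fun τ' h => hfg τ' (by
      rwa [add_assoc, add_comm 1 b] at h)) hτ) hσ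

theorem joinOp_pow_mono (hm : 2 ≤ m) {f g : PartialCubic n → ℝ} (a : ℕ)
    (hfg : ∀ τ, τ.Valid m j l → f τ ≤ g τ) (hσ : σ.Valid m (j + 2 * a) l) :
    (joinOp n m ^ a) f σ ≤ (joinOp n m ^ a) g σ := by
  induction a generalizing σ with
  | zero => exact hfg σ hσ
  | succ a ih =>
    rw [pow_succ', Module.End.mul_apply, Module.End.mul_apply]
    exact joinOp_mono hm (fun τ hτ => ih hτ) hσ

/-- The operator that joins `a` pairs of half-edges and uses up `b` others. -/
noncomputable def buildOp (n m : ℕ) (q : ℝ) (a b : ℕ) : Module.End ℝ (PartialCubic n → ℝ) :=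
  joinOp n m ^ a * warnOp n q ^ b

theorem buildOp_mono (hm : 2 ≤ m) (hq0 : 0 ≤ q) (hq1 : q ≤ 1) {f g : PartialCubic n → ℝ} (a b : ℕ)
    (hfg : ∀ τ, τ.Valid m j (l + b) → f τ ≤ g τ) (hσ : σ.Valid m (j + b + 2 * a) l) :
    buildOp n m q a b f σ ≤ buildOp n m q a b g σ :=
  joinOp_pow_mono hm a (fun _ hτ => warnOp_pow_mono hq0 hq1 b hfg hτ) hσ

theorem buildOp_succ_left (a b : ℕ) (f : PartialCubic n → ℝ) :
    buildOp n m q (a + 1) b f = buildOp n m q a b (joinOp n m f) := by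
  have h := ((commute_joinOp_warnOp (n := n) m q).pow_right b).eq
  rw [buildOp, buildOp, pow_succ, mul_assoc, h, ← mul_assoc]
  rfl

theorem buildOp_succ_right (a b : ℕ) (f : PartialCubic n → ℝ) :
    buildOp n m q a (b + 1) f = buildOp n m q a b (warnOp n q f) := by
  rw [buildOp, buildOp, pow_succ, ← mul_assoc]
  rfl

theorem warnOp_pow_const (c : ℝ) (b : ℕ) (hσ : σ.Valid m j l) :
    (warnOp n q ^ b) (fun _ => c) σ = (j.descFactorial b : ℝ) * c := by
  induction b generalizing σ j l with
  | zero => simp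
  | succ b ih =>
    rw [pow_succ', Module.End.mul_apply, warnOp_apply]
    cases j with
    | zero =>
      have := hσ.card_free
      rw [Finset.card_eq_zero] at this
      simp [this]
    | succ j =>
      have : ∀ u ∈ σ.free, ((1 - q) * (warnOp n q ^ b) (fun _ => c) (σ.use u) +
          q * (warnOp n q ^ b) (fun _ => c) (σ.kill u)) = (j.descFactorial b : ℝ) * c := by
        intro u hu
        rw [ih (hσ.use hu), ih (hσ.kill hu)]
        ring
      rw [Finset.sum_congr rfl this, Finset.sum_const, hσ.card_free, nsmul_eq_mul,
        Nat.succ_descFactorial_succ]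
      push_cast
      ring

/-- Most pairs of free half-edges are far apart. -/
theorem le_joinOp_const {c : ℝ} (hc : 0 ≤ c) (hσ : σ.Valid m j l) :
    (j : ℝ) * (j - 1 - 3 * 4 ^ m) * c ≤ joinOp n m (fun _ => c) σ := by
  classical
  rw [joinOp_apply, mul_assoc, ← hσ.card_free, ← nsmul_eq_mul, ← Finset.sum_const]
  refine Finset.sum_le_sum fun u hu => ?_
  rw [← Finset.sum_filter, Finset.sum_const, nsmul_eq_mul]
  refine mul_le_mul_of_nonneg_right ?_ hc
  obtain ⟨Z, hZ, hZ'⟩ := exists_near_finset hσ.valency_le u.1 m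
  have h1 := Finset.card_filter_add_card_filter_not (s := σ.free.erase u)
    (fun v => FarApart m σ.graph u.1 v.1)
  have h2 : ((σ.free.erase u).filter fun v => ¬ FarApart m σ.graph u.1 v.1).card ≤ 3 * 4 ^ m := by
    calc _ ≤ (Z ×ˢ (Finset.univ : Finset (Fin 3))).card := by
          refine Finset.card_le_card fun v hv => ?_
          simp only [Finset.mem_filter, FarApart, not_forall, not_le] at hv
          obtain ⟨-, w, hw⟩ := hv
          simpa using hZ' _ w hw.le
      _ ≤ 3 * 4 ^ m := by
          rw [Finset.card_product, Finset.card_univ, Fintype.card_fin]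
          omega
  have h3 := Finset.card_erase_add_one hu
  have h4 : σ.free.card ≤
      ((σ.free.erase u).filter fun v => FarApart m σ.graph u.1 v.1).card + 3 * 4 ^ m + 1 := by
    omega
  have h5 : (σ.free.card : ℝ) ≤
      (((σ.free.erase u).filter fun v => FarApart m σ.graph u.1 v.1).card : ℝ) + 3 * 4 ^ m + 1 := by
    exact_mod_cast h4
  linarith

/-- Here `θ` bounds from below the fraction of far partners of a half-edge; each join loses at most
this factor against the count of all ordered pairs. -/
theorem le_joinOp_pow (hm : 2 ≤ m) {j₀ : ℕ} {θ c : ℝ} (hθ0 : 0 ≤ θ) (hc : 0 ≤ c)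
    (hj : ∀ i : ℕ, j₀ ≤ i → θ * (i + 1) ≤ i + 1 - 3 * 4 ^ m)
    {f : PartialCubic n → ℝ} (hf : ∀ τ, τ.Valid m j l → c ≤ f τ) (hj0 : j₀ ≤ j) (a : ℕ)
    (hσ : σ.Valid m (j + 2 * a) l) :
    θ ^ a * ((j + 2 * a).descFactorial (2 * a) : ℝ) * c ≤ (joinOp n m ^ a) f σ := by
  induction a generalizing σ with
  | zero => simpa using hf σ hσ
  | succ a ih =>
    rw [pow_succ' (joinOp n m), pow_succ' θ, Module.End.mul_apply]
    refine le_trans ?_ (joinOp_mono hm (fun τ hτ => ih hτ) hσ)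
    refine le_trans ?_ (le_joinOp_const (by positivity) hσ)
    have h1 : (j + 2 * (a + 1)).descFactorial (2 * (a + 1)) =
        (j + 2 * a + 2) * ((j + 2 * a + 1) * (j + 2 * a).descFactorial (2 * a)) := by
      rw [← Nat.succ_descFactorial_succ, ← Nat.succ_descFactorial_succ]
      rfl
    have h2 := hj (j + 2 * a) (by omega)
    rw [h1]
    push_cast at h2 ⊢
    calc θ * θ ^ a * ((j + 2 * a + 2) * ((j + 2 * a + 1) *
            ((j + 2 * a).descFactorial (2 * a) : ℝ))) * c
        = (j + 2 * a + 2) * (θ * (j + 2 * a + 1)) *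
            (θ ^ a * ((j + 2 * a).descFactorial (2 * a) : ℝ) * c) := by ring
      _ ≤ (j + 2 * a + 2) * (j + 2 * a + 1 - 3 * 4 ^ m) *
            (θ ^ a * ((j + 2 * a).descFactorial (2 * a) : ℝ) * c) := by gcongr
      _ = _ := by ring

theorem le_buildOp (hm : 2 ≤ m) (hq0 : 0 ≤ q) (hq1 : q ≤ 1) {j₀ : ℕ} {θ c : ℝ} (hθ0 : 0 ≤ θ)
    (hc : 0 ≤ c) (hj : ∀ i : ℕ, j₀ ≤ i → θ * (i + 1) ≤ i + 1 - 3 * 4 ^ m)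
    {f : PartialCubic n → ℝ} {a b : ℕ} (hf : ∀ τ, τ.Valid m j (l + b) → c ≤ f τ) (hj0 : j₀ ≤ j)
    (hσ : σ.Valid m (j + b + 2 * a) l) :
    θ ^ a * ((j + b + 2 * a).descFactorial (2 * a + b) : ℝ) * c ≤ buildOp n m q a b f σ := by
  have h1 : ∀ τ : PartialCubic n, τ.Valid m (j + b) l →
      ((j + b).descFactorial b : ℝ) * c ≤ (warnOp n q ^ b) f τ := fun τ hτ => by
    rw [← warnOp_pow_const (q := q) c b hτ]
    exact warnOp_pow_mono hq0 hq1 b hf hτ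
  have h2 := le_joinOp_pow hm hθ0 (by positivity) hj h1 (by omega) a hσ
  have h3 : (j + b + 2 * a).descFactorial (2 * a + b) =
      (j + b + 2 * a).descFactorial (2 * a) * (j + b).descFactorial b := by
    rw [← Nat.descFactorial_mul_descFactorial (k := 2 * a) (m := 2 * a + b) (by omega)]
    rw [show 2 * a + b - 2 * a = b by omega, show j + b + 2 * a - 2 * a = j + b by omega]
    ring
  rw [h3]
  push_cast
  calc _ = θ ^ a * ((j + b + 2 * a).descFactorial (2 * a) : ℝ) *
      (((j + b).descFactorial b : ℝ) * c) := by ring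
    _ ≤ _ := h2

end PartialCubic

/-! ### Independent sets avoiding deleted vertices, and frozen vertices -/

open Classical in
/-- The largest size of an independent set avoiding `X`. -/
noncomputable def indepNumOff {V : Type*} [Fintype V] (G : SimpleGraph V) (X : Finset V) : ℕ :=
  (Finset.univ.filter fun s : Finset V => G.IsIndepSet s ∧ Disjoint s X).sup Finset.card

/-- `i` belongs to every largest independent set avoiding `X`. -/
def Frozen {V : Type*} [Fintype V] (G : SimpleGraph V) (X : Finset V) (i : V) : Prop :=
  ∀ s : Finset V, G.IsIndepSet s → Disjoint s X → s.card = indepNumOff G X → i ∈ s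

section IndepNumOff

variable {V : Type*} [Fintype V] {G : SimpleGraph V} {X : Finset V}

theorem card_le_indepNumOff {s : Finset V} (hs : G.IsIndepSet s) (hX : Disjoint s X) :
    s.card ≤ indepNumOff G X :=
  Finset.le_sup (f := Finset.card) (by simp [hs, hX])

theorem exists_card_eq_indepNumOff (G : SimpleGraph V) (X : Finset V) :
    ∃ s : Finset V, G.IsIndepSet s ∧ Disjoint s X ∧ s.card = indepNumOff G X := by
  classical
  obtain ⟨s, hs, h⟩ := Finset.exists_mem_eq_sup
    (Finset.univ.filter fun s : Finset V => G.IsIndepSet s ∧ Disjoint s X)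
    ⟨∅, by simp [SimpleGraph.IsIndepSet]⟩ Finset.card
  simp only [Finset.mem_filter, Finset.mem_univ, true_and] at hs
  exact ⟨s, hs.1, hs.2, h.symm⟩

theorem indepNumOff_anti {H : SimpleGraph V} (h : G ≤ H) : indepNumOff H X ≤ indepNumOff G X := by
  obtain ⟨s, hs, hX, hc⟩ := exists_card_eq_indepNumOff H X
  rw [← hc]
  exact card_le_indepNumOff (fun a ha b hb hab hadj => hs ha hb hab (h hadj)) hX

/-- If the value did not drop, an optimal set of the larger graph would be optimal for `G`, and so
would contain both ends of the new edge. -/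
theorem indepNumOff_sup_edge_lt {a b : V} (hab : a ≠ b) (ha : Frozen G X a) (hb : Frozen G X b) :
    indepNumOff (G ⊔ SimpleGraph.edge a b) X + 1 ≤ indepNumOff G X := by
  obtain ⟨s, hs, hX, hc⟩ := exists_card_eq_indepNumOff (G ⊔ SimpleGraph.edge a b) X
  have hs' : G.IsIndepSet s := fun p hp q hq hpq hadj => hs hp hq hpq (Or.inl hadj)
  refine (indepNumOff_anti le_sup_left).lt_of_ne fun heq => ?_
  rw [heq] at hc
  exact hs (ha s hs' hX hc) (hb s hs' hX hc) hab
    (Or.inr ((SimpleGraph.edge_adj ..).2 ⟨Or.inl ⟨rfl, rfl⟩, hab⟩))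

theorem indepNumOff_le_insert [DecidableEq V] (i : V) :
    indepNumOff G X ≤ indepNumOff G (insert i X) + 1 := by
  obtain ⟨s, hs, hX, hc⟩ := exists_card_eq_indepNumOff G X
  have h1 : (s.erase i).card ≤ indepNumOff G (insert i X) := by
    refine card_le_indepNumOff (fun a ha b hb => hs ?_ ?_) ?_
    · exact Finset.mem_of_mem_erase ha
    · exact Finset.mem_of_mem_erase hb
    · rw [Finset.disjoint_insert_right]
      exact ⟨Finset.notMem_erase i s, hX.mono_left (Finset.erase_subset i s)⟩
  have := Finset.pred_card_le_card_erase (s := s) (a := i)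
  omega

theorem indepNumOff_le_insert_of_not_frozen [DecidableEq V] {i : V} (h : ¬ Frozen G X i) :
    indepNumOff G X ≤ indepNumOff G (insert i X) := by
  simp only [Frozen, not_forall] at h
  obtain ⟨s, hs, hX, hc, hi⟩ := h
  rw [← hc]
  exact card_le_indepNumOff hs (Finset.disjoint_insert_right.2 ⟨hi, hX⟩)

theorem indepNumOff_bot [DecidableEq V] : indepNumOff (⊥ : SimpleGraph V) X = Xᶜ.card := by
  refine le_antisymm ?_ (card_le_indepNumOff (fun a _ b _ _ => by simp) disjoint_compl_left)
  obtain ⟨s, -, hX, hc⟩ := exists_card_eq_indepNumOff (⊥ : SimpleGraph V) X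
  rw [← hc]
  exact Finset.card_le_card hX.le_compl_right

theorem indepNum_le_indepNumOff_empty : G.indepNum ≤ indepNumOff G ∅ := by
  obtain ⟨s, hs⟩ := G.exists_isNIndepSet_indepNum
  rw [← hs.card_eq]
  exact card_le_indepNumOff hs.isIndepSet (Finset.disjoint_empty_right s)

end IndepNumOff

/-! ### Boltzmann weights and the interpolation inequality -/

namespace PartialCubic

variable {n m j l : ℕ} {σ : PartialCubic n} {q lam : ℝ}

/-- The Boltzmann weight of the largest independent set avoiding the deleted vertices. -/
noncomputable def weight (lam : ℝ) (σ : PartialCubic n) : ℝ :=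
  lam ^ indepNumOff σ.graph σ.deleted

open Classical in
/-- The number of free half-edges at frozen vertices. -/
noncomputable def frozenCount (σ : PartialCubic n) : ℝ :=
  ∑ u ∈ σ.free, if Frozen σ.graph σ.deleted u.1 then 1 else 0

theorem one_le_weight (hlam : 1 ≤ lam) : 1 ≤ weight lam σ := one_le_pow₀ hlam

theorem frozenCount_nonneg : 0 ≤ σ.frozenCount :=
  Finset.sum_nonneg fun _ _ => by split_ifs <;> norm_num

theorem frozenCount_le : σ.frozenCount ≤ σ.free.card := by
  rw [← nsmul_one, ← Finset.sum_const]
  exact Finset.sum_le_sum fun _ _ => by split_ifs <;> norm_num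

/-- Joining two frozen vertices costs a factor `lam` at least, and no join raises the weight. -/
theorem joinOp_weight_le (hm : 1 ≤ m) (hlam : 1 ≤ lam) :
    joinOp n m (weight lam) σ ≤
      weight lam σ * ((σ.free.card : ℝ) ^ 2 - (1 - lam⁻¹) * σ.frozenCount ^ 2) := by
  classical
  set χ : Fin n × Fin 3 → ℝ := fun u => if Frozen σ.graph σ.deleted u.1 then 1 else 0 with hχ
  have hw : 0 ≤ weight lam σ := zero_le_one.trans (one_le_weight hlam)
  have hc : 0 ≤ 1 - lam⁻¹ := sub_nonneg.2 (inv_le_one_of_one_le₀ hlam)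
  have hinv : 0 ≤ lam⁻¹ := by positivity
  have hχχ : ∀ u v, 0 ≤ 1 - (1 - lam⁻¹) * (χ u * χ v) := fun u v => by
    simp only [hχ]
    split_ifs <;> simp [hinv]
  have hsum : weight lam σ * ((σ.free.card : ℝ) ^ 2 - (1 - lam⁻¹) * σ.frozenCount ^ 2) =
      ∑ u ∈ σ.free, ∑ v ∈ σ.free, weight lam σ * (1 - (1 - lam⁻¹) * (χ u * χ v)) := by
    simp only [← Finset.mul_sum, Finset.sum_sub_distrib, ← Finset.sum_mul, frozenCount]
    simp only [Finset.sum_const, nsmul_eq_mul, mul_one, ← hχ]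
    ring
  rw [hsum, joinOp_apply]
  refine Finset.sum_le_sum fun u _ => ?_
  -- The diagonal is put back, and later the near pairs, all with nonnegative terms, so that the
  -- double sum factorises into squares.
  refine le_trans (Finset.sum_le_sum fun v _ => ?_)
    (Finset.sum_le_sum_of_subset_of_nonneg (Finset.erase_subset u σ.free)
      fun v _ _ => mul_nonneg hw (hχχ u v))
  split_ifs with h
  · by_cases huv : Frozen σ.graph σ.deleted u.1 ∧ Frozen σ.graph σ.deleted v.1
    · have h1 := indepNumOff_sup_edge_lt (h.ne hm) huv.1 huv.2
      have h2 : lam * weight lam (σ.join u v) ≤ weight lam σ := by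
        simp only [weight, join]
        rw [← pow_succ']
        exact pow_le_pow_right₀ hlam h1
      simp only [hχ, if_pos huv.1, if_pos huv.2, mul_one, sub_sub_cancel]
      rw [← div_eq_mul_inv, le_div_iff₀ (by linarith)]
      linarith
    · have h0 : χ u * χ v = 0 := by
        simp only [hχ]
        split_ifs <;> simp_all
      rw [h0, mul_zero, sub_zero, mul_one]
      exact pow_le_pow_right₀ hlam (indepNumOff_anti le_sup_left)
  · exact mul_nonneg hw (hχχ u v)

/-- Deleting a vertex costs a factor `lam` at most, and nothing unless the vertex is frozen. The
bound is the opposite of that for joins, as the interpolation requires. -/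
theorem le_warnOp_weight (hlam : 1 ≤ lam) (hq0 : 0 ≤ q) :
    weight lam σ * ((σ.free.card : ℝ) - (1 - lam⁻¹) * q * σ.frozenCount) ≤
      warnOp n q (weight lam) σ := by
  classical
  set χ : Fin n × Fin 3 → ℝ := fun u => if Frozen σ.graph σ.deleted u.1 then 1 else 0 with hχ
  have hsum : weight lam σ * ((σ.free.card : ℝ) - (1 - lam⁻¹) * q * σ.frozenCount) =
      ∑ u ∈ σ.free, weight lam σ * (1 - (1 - lam⁻¹) * q * χ u) := by
    simp only [← Finset.mul_sum, Finset.sum_sub_distrib, frozenCount]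
    simp [← hχ]
  rw [hsum, warnOp_apply]
  refine Finset.sum_le_sum fun u _ => ?_
  have hkill : weight lam σ * (1 - (1 - lam⁻¹) * χ u) ≤ weight lam (σ.kill u) := by
    by_cases hu : Frozen σ.graph σ.deleted u.1
    · have h2 : weight lam σ ≤ lam * weight lam (σ.kill u) := by
        simp only [weight, kill]
        rw [← pow_succ']
        exact pow_le_pow_right₀ hlam (indepNumOff_le_insert u.1)
      simp only [hχ, if_pos hu, mul_one, sub_sub_cancel]
      rw [← div_eq_mul_inv, div_le_iff₀ (by linarith)]
      linarith
    · simp only [hχ, if_neg hu, mul_zero, sub_zero, mul_one]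
      exact pow_le_pow_right₀ hlam (indepNumOff_le_insert_of_not_frozen hu)
  have huse : weight lam (σ.use u) = weight lam σ := rfl
  rw [huse]
  have := mul_le_mul_of_nonneg_left hkill hq0
  linarith

/-- The sum of the weights over all ways of joining `a` pairs of half-edges and using up `b`
others. -/
noncomputable def partition (n m : ℕ) (q lam : ℝ) (a b : ℕ) : ℝ :=
  buildOp n m q a b (weight lam) (init n)

theorem buildOp_init_mono (hm : 2 ≤ m) (hq0 : 0 ≤ q) (hq1 : q ≤ 1) {f g : PartialCubic n → ℝ}
    {a b : ℕ} (hab : 2 * a + b ≤ 3 * n)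
    (hfg : ∀ τ, τ.Valid m (3 * n - (2 * a + b)) b → f τ ≤ g τ) :
    buildOp n m q a b f (init n) ≤ buildOp n m q a b g (init n) := by
  refine buildOp_mono (j := 3 * n - (2 * a + b)) (l := 0) hm hq0 hq1 a b (by simpa using hfg) ?_
  convert init_valid n m using 1
  omega

/-- The interpolation inequality: compared with joining two half-edges, using up one of them has
at least the square root of the effect, up to the factor `1 - (1 - lam⁻¹) q²`. -/
theorem partition_mul_partition_le (hm : 2 ≤ m) (hlam : 1 ≤ lam) (hq0 : 0 ≤ q) (hq1 : q ≤ 1)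
    {a b : ℕ} (hab : 2 * a + b < 3 * n) (hpos : 0 < partition n m q lam a b) :
    partition n m q lam (a + 1) b * partition n m q lam a b * (1 - (1 - lam⁻¹) * q ^ 2) ≤
      partition n m q lam a (b + 1) ^ 2 := by
  set Φ := buildOp n m q a b with hΦ
  set s : ℝ := ((3 * n - (2 * a + b) : ℕ) : ℝ) with hs
  have hs0 : 0 < s := by rw [hs]; exact_mod_cast Nat.sub_pos_of_lt hab
  set f : PartialCubic n → ℝ := weight lam with hf
  set S := Φ f (init n) with hS
  have hSpos : 0 < S := hpos
  set Y := Φ (fun τ => f τ * τ.frozenCount) (init n) with hY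
  have hc0 : 0 ≤ 1 - lam⁻¹ := sub_nonneg.2 (inv_le_one_of_one_le₀ hlam)
  have hc1 : 1 - lam⁻¹ ≤ 1 := by
    have : 0 ≤ lam⁻¹ := by positivity
    linarith
  set c := 1 - lam⁻¹ with hc
  have hf0 : ∀ τ, 0 ≤ f τ := fun τ => zero_le_one.trans (one_le_weight hlam)
  have hcomb : ∀ p r : ℝ, Φ (p • f + r • fun τ => f τ * τ.frozenCount) (init n) = p * S + r * Y :=
    fun p r => by simp [hS, hY]
  have hmono := fun (g h : PartialCubic n → ℝ) => buildOp_init_mono (f := g) (g := h) hm hq0 hq1 hab.le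
  -- The mean fraction of free half-edges at frozen vertices, with respect to the weights.
  set x := Y / (s * S) with hx
  have hYx : Y = x * (s * S) := by rw [hx]; field_simp
  have hY1 : Y ≤ s * S := by
    have := hmono (fun τ => f τ * τ.frozenCount) (s • f + (0 : ℝ) • fun τ => f τ * τ.frozenCount)
      fun τ hτ => by
        simp only [Pi.add_apply, Pi.smul_apply, smul_eq_mul, zero_mul, add_zero]
        rw [mul_comm]
        refine mul_le_mul_of_nonneg_right ?_ (hf0 τ)
        rw [hs, ← hτ.card_free]
        exact frozenCount_le
    rw [hcomb] at this
    linarith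
  have hx1 : x ≤ 1 := by
    rw [hx, div_le_one (by positivity)]
    exact hY1
  have hjoin : partition n m q lam (a + 1) b ≤ s ^ 2 * S * (1 - c * x ^ 2) := by
    -- Jensen's inequality in tangent-line form: the square of `frozenCount` is replaced by its
    -- tangent at the mean `x * s`, which is linear and can be averaged.
    have h1 := hmono (joinOp n m f) ((s ^ 2 * (1 + c * x ^ 2)) • f +
      (-(2 * c * x * s)) • fun τ => f τ * τ.frozenCount) fun τ hτ => by
        refine (joinOp_weight_le (by omega) hlam).trans ?_
        rw [hτ.card_free]
        simp only [Pi.add_apply, Pi.smul_apply, smul_eq_mul]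
        have h2 := mul_nonneg (mul_nonneg (hf0 τ) hc0) (sq_nonneg (τ.frozenCount - x * s))
        linarith
    rw [hcomb, hYx] at h1
    rw [partition, buildOp_succ_left]
    refine h1.trans (le_of_eq ?_)
    ring
  have hwarn : s * S * (1 - c * q * x) ≤ partition n m q lam a (b + 1) := by
    have h1 := hmono (s • f + (-(c * q)) • fun τ => f τ * τ.frozenCount) (warnOp n q f)
      fun τ hτ => by
        refine le_trans (le_of_eq ?_) (le_warnOp_weight hlam hq0)
        rw [hτ.card_free]
        simp only [Pi.add_apply, Pi.smul_apply, smul_eq_mul]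
        ring
    rw [hcomb, hYx] at h1
    rw [partition, buildOp_succ_right]
    refine le_trans (le_of_eq ?_) h1
    ring
  have hcq : c * q ≤ 1 := mul_le_one₀ hc1 hq0 hq1
  have hcqx : 0 ≤ 1 - c * q * x := by
    have := mul_le_mul_of_nonneg_left hx1 (mul_nonneg hc0 hq0)
    linarith
  have hcq2 : 0 ≤ 1 - c * q ^ 2 := by
    have := mul_le_one₀ hcq hq0 hq1
    nlinarith
  have halg : (1 - c * x ^ 2) * (1 - c * q ^ 2) ≤ (1 - c * q * x) ^ 2 := by
    have := mul_nonneg hc0 (sq_nonneg (q - x))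
    linarith
  calc partition n m q lam (a + 1) b * S * (1 - c * q ^ 2)
      ≤ s ^ 2 * S * (1 - c * x ^ 2) * S * (1 - c * q ^ 2) := by gcongr
    _ = (s * S) ^ 2 * ((1 - c * x ^ 2) * (1 - c * q ^ 2)) := by ring
    _ ≤ (s * S) ^ 2 * (1 - c * q * x) ^ 2 := by gcongr
    _ = (s * S * (1 - c * q * x)) ^ 2 := by ring
    _ ≤ _ := by gcongr

/-- Each discard lowers the independence number by at most one, so discarding all remaining
half-edges loses at most `lam ^ j`. This reduces partial states to fully discarded ones, where the
weight can be computed exactly. -/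
theorem factorial_mul_weight_le (hlam : 1 ≤ lam) (hq0 : 0 ≤ q) (hq1 : q ≤ 1)
    (hσ : σ.Valid m j l) :
    (j.factorial : ℝ) * weight lam σ ≤ lam ^ j * (warnOp n q ^ j) (weight lam) σ := by
  induction j generalizing l σ with
  | zero => simp
  | succ j ih =>
    have hw : 0 ≤ weight lam σ := zero_le_one.trans (one_le_weight hlam)
    have hc0 : 0 ≤ 1 - lam⁻¹ := sub_nonneg.2 (inv_le_one_of_one_le₀ hlam)
    have h1 : ((j : ℝ) + 1) * weight lam σ ≤ lam * warnOp n q (weight lam) σ := by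
      have h2 : ((j : ℝ) + 1) * lam⁻¹ ≤
          (σ.free.card : ℝ) - (1 - lam⁻¹) * q * σ.frozenCount := by
        have h3 : (1 - lam⁻¹) * q * σ.frozenCount ≤ (1 - lam⁻¹) * σ.free.card := by
          refine mul_le_mul ?_ frozenCount_le frozenCount_nonneg hc0
          exact mul_le_of_le_one_right hc0 hq1
        rw [hσ.card_free] at h3 ⊢
        push_cast at h3 ⊢
        linarith
      have h4 := (mul_le_mul_of_nonneg_left h2 hw).trans (le_warnOp_weight hlam hq0)
      have h5 := mul_le_mul_of_nonneg_left h4 (zero_le_one.trans hlam)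
      refine le_trans (le_of_eq ?_) h5
      field_simp
    have h6 := warnOp_mono (f := (j.factorial : ℝ) • weight lam)
      (g := lam ^ j • (warnOp n q ^ j) (weight lam)) hq0 hq1 (fun τ hτ => ih hτ) hσ
    rw [map_smul, map_smul] at h6
    simp only [Pi.smul_apply, smul_eq_mul] at h6
    rw [pow_succ' (warnOp n q), Module.End.mul_apply, pow_succ lam, Nat.factorial_succ]
    push_cast
    calc ((j : ℝ) + 1) * j.factorial * weight lam σ
        = j.factorial * (((j : ℝ) + 1) * weight lam σ) := by ring
      _ ≤ j.factorial * (lam * warnOp n q (weight lam) σ) := by gcongr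
      _ = lam * (j.factorial * warnOp n q (weight lam) σ) := by ring
      _ ≤ lam * (lam ^ j * warnOp n q ((warnOp n q ^ j) (weight lam)) σ) := by gcongr
      _ = _ := by ring

/-- If no edges are built, then all vertices are independent of each other. -/
theorem warnOp_pow_weight_of_graph_eq_bot (hσ : σ.graph = ⊥) (hj : σ.free.card = j) :
    (warnOp n q ^ j) (weight lam) σ = j.factorial * ∏ i, if i ∈ σ.deleted then 1 else
      1 + (lam - 1) * (1 - q) ^ (σ.free.filter fun u => u.1 = i).card := by
  induction j generalizing σ with
  | zero =>
    rw [Finset.card_eq_zero] at hj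
    simp only [pow_zero, Module.End.one_apply, weight, hσ, indepNumOff_bot, hj, Finset.filter_empty,
      Finset.card_empty, mul_one, add_sub_cancel, Nat.factorial_zero, Nat.cast_one, one_mul]
    rw [Finset.prod_ite, Finset.prod_const_one, one_mul, Finset.prod_const]
    congr 2
    ext i
    simp
  | succ j ih =>
    rw [pow_succ', Module.End.mul_apply, warnOp_apply]
    have hterm : ∀ u ∈ σ.free, (1 - q) * (warnOp n q ^ j) (weight lam) (σ.use u) +
        q * (warnOp n q ^ j) (weight lam) (σ.kill u) =
        j.factorial * ∏ i, if i ∈ σ.deleted then 1 else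
          1 + (lam - 1) * (1 - q) ^ (σ.free.filter fun u => u.1 = i).card := by
      intro u hu
      have hcard : (σ.free.erase u).card = j := by
        rw [Finset.card_erase_of_mem hu, hj]; rfl
      rw [ih (σ := σ.use u) hσ hcard, ih (σ := σ.kill u) hσ hcard]
      simp only [← Finset.mul_prod_erase Finset.univ _ (Finset.mem_univ u.1)]
      have hne : ∀ i ∈ Finset.univ.erase u.1,
          ((σ.free.erase u).filter fun v => v.1 = i) = σ.free.filter fun v => v.1 = i := by
        intro i hi
        rw [Finset.filter_erase, Finset.erase_eq_of_notMem]
        have := Finset.ne_of_mem_erase hi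
        simp [this.symm]
      have hrest1 : ∏ i ∈ Finset.univ.erase u.1, (if i ∈ (σ.use u).deleted then (1 : ℝ) else
            1 + (lam - 1) * (1 - q) ^ ((σ.use u).free.filter fun v => v.1 = i).card) =
          ∏ i ∈ Finset.univ.erase u.1, (if i ∈ σ.deleted then (1 : ℝ) else
            1 + (lam - 1) * (1 - q) ^ (σ.free.filter fun v => v.1 = i).card) :=
        Finset.prod_congr rfl fun i hi => by simp only [use, hne i hi]
      have hrest2 : ∏ i ∈ Finset.univ.erase u.1, (if i ∈ (σ.kill u).deleted then (1 : ℝ) else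
            1 + (lam - 1) * (1 - q) ^ ((σ.kill u).free.filter fun v => v.1 = i).card) =
          ∏ i ∈ Finset.univ.erase u.1, (if i ∈ σ.deleted then (1 : ℝ) else
            1 + (lam - 1) * (1 - q) ^ (σ.free.filter fun v => v.1 = i).card) :=
        Finset.prod_congr rfl fun i hi => by
          simp only [kill, hne i hi, Finset.mem_insert, Finset.ne_of_mem_erase hi, false_or]
      rw [hrest1, hrest2]
      have hat : ((σ.free.erase u).filter fun v => v.1 = u.1).card + 1 =
          (σ.free.filter fun v => v.1 = u.1).card := by
        rw [Finset.filter_erase]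
        exact Finset.card_erase_add_one (by simp [hu])
      -- For a surviving vertex with `d + 1` free half-edges, `(1 - q) (1 + (lam - 1)(1 - q)^d) + q`
      -- equals `1 + (lam - 1)(1 - q)^(d + 1)`.
      by_cases hX : u.1 ∈ σ.deleted
      · simp only [use, kill, Finset.mem_insert_self, if_true, hX]
        ring
      · simp only [use, kill, Finset.mem_insert_self, if_true, hX, if_false, ← hat]
        ring
    rw [Finset.sum_congr rfl hterm, Finset.sum_const, hj, nsmul_eq_mul, Nat.factorial_succ]
    push_cast
    ring

theorem partition_zero_le (hlam : 1 ≤ lam) (hq0 : 0 ≤ q) (hq1 : q ≤ 1) {b : ℕ}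
    (hb : b ≤ 3 * n) :
    partition n m q lam 0 b ≤ lam ^ (3 * n - b) * (3 * n).descFactorial b *
      (1 + (lam - 1) * (1 - q) ^ 3) ^ n := by
  obtain ⟨j, hj⟩ := Nat.exists_eq_add_of_le hb
  have hinit : (init n).Valid m (j + b) 0 := by
    convert init_valid n m using 1
    omega
  have h1 := warnOp_pow_mono (f := (j.factorial : ℝ) • weight lam)
    (g := lam ^ j • (warnOp n q ^ j) (weight lam)) hq0 hq1 b
    (fun τ hτ => factorial_mul_weight_le hlam hq0 hq1 hτ) hinit
  rw [map_smul, map_smul] at h1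
  simp only [Pi.smul_apply, smul_eq_mul] at h1
  have hprod : (∏ i : Fin n, if i ∈ (init n).deleted then (1 : ℝ) else
      1 + (lam - 1) * (1 - q) ^ ((init n).free.filter fun u => u.1 = i).card) =
      (1 + (lam - 1) * (1 - q) ^ 3) ^ n := by
    simp [init, card_filter_fst_eq]
  rw [← Module.End.mul_apply, ← pow_add, show b + j = 3 * n by omega,
    warnOp_pow_weight_of_graph_eq_bot (j := 3 * n) rfl (init_valid n m).card_free, hprod,
    ← Nat.factorial_mul_descFactorial hb, show 3 * n - b = j by omega] at h1
  have hfac : (0 : ℝ) < j.factorial := by exact_mod_cast j.factorial_pos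
  have h2 : partition n m q lam 0 b = (warnOp n q ^ b) (weight lam) (init n) := by
    rw [partition, buildOp, pow_zero, one_mul]
  rw [h2, show 3 * n - b = j by omega]
  refine le_of_mul_le_mul_left (h1.trans (le_of_eq ?_)) hfac
  push_cast
  ring

end PartialCubic

/-! ### The comparison principle -/

/-- A discrete comparison principle: the linear and quadratic functions of `2 * k + l` are
subsolutions of the averaging inequality `hstep`. -/
theorem quadratic_le_of_average_le {g : ℕ → ℕ → ℝ} {N : ℕ} {M w p t r κ C : ℝ} (hr : 0 ≤ r)
    (hκ : 0 ≤ κ)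
    (hstep : ∀ k l : ℕ, 2 * k + l + 2 ≤ N → g (k + 1) l + g k l ≤ 2 * g k (l + 1) + 2 * κ)
    (hlow : ∀ k l : ℕ, 2 * k + l ≤ N → -C ≤ g k l)
    (hbase : ∀ k : ℕ, 2 * k ≤ N → p + t * (2 * k - M) ≤ g k 0)
    (hw : (N : ℝ) = M + w) (hbdry : p + t * w - r * w ^ 2 ≤ -C) (k l : ℕ) (hkl : 2 * k + l ≤ N) :
    p + t * (2 * k + l - M) - r * ((2 * k + l - M) ^ 2 + l) - l * κ ≤ g k l := by
  induction l generalizing k with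
  | zero =>
    have h1 := hbase k (by omega)
    have h2 := mul_nonneg hr (sq_nonneg (2 * (k : ℝ) - M))
    push_cast
    simp only [add_zero, zero_mul, sub_zero]
    linarith
  | succ l ih =>
    -- Here the lower bound satisfies the averaging relation with equality: the summand `l` beside
    -- the square absorbs its second difference, and `l * κ` the error of each step.
    by_cases h : 2 * k + l + 2 ≤ N
    · have h1 := ih k (by omega)
      have h2 := ih (k + 1) (by omega)
      have h3 := hstep k l h
      push_cast at h1 h2 h3 ⊢
      linarith
    -- On the frontier no step is available, but there the quadratic term has pushed the claim below
    -- the trivial bound `-C`.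
    · have h1 : 2 * (k : ℝ) + (l + 1 : ℕ) = N := by exact_mod_cast (by omega : 2 * k + (l + 1) = N)
      rw [h1, show (N : ℝ) - M = w by linarith]
      have h2 := hlow k (l + 1) hkl
      have h3 : 0 ≤ r * ((l + 1 : ℕ) : ℝ) := by positivity
      have h4 : 0 ≤ ((l + 1 : ℕ) : ℝ) * κ := by positivity
      linarith

/-! ### Estimates for the free energy -/

namespace PartialCubic

variable {n m : ℕ} {q lam : ℝ}

/-- The logarithm of the average weight. -/
noncomputable def freeEnergy (n m : ℕ) (q lam : ℝ) (a b : ℕ) : ℝ :=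
  Real.log (partition n m q lam a b / (3 * n).descFactorial (2 * a + b))

theorem descFactorial_pos {a b : ℕ} (h : b ≤ a) : (0 : ℝ) < a.descFactorial b := by
  exact_mod_cast Nat.pos_of_ne_zero fun h0 => absurd (Nat.descFactorial_eq_zero_iff_lt.1 h0) (by omega)

theorem le_partition (hm : 2 ≤ m) (hq0 : 0 ≤ q) (hq1 : q ≤ 1) {j₀ : ℕ} {θ c : ℝ} (hθ0 : 0 ≤ θ)
    (hc : 0 ≤ c) (hj : ∀ i : ℕ, j₀ ≤ i → θ * (i + 1) ≤ i + 1 - 3 * 4 ^ m) {a b : ℕ}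
    (hab : 2 * a + b + j₀ ≤ 3 * n)
    (hf : ∀ τ : PartialCubic n, τ.Valid m (3 * n - (2 * a + b)) b → c ≤ weight lam τ) :
    θ ^ a * c * (3 * n).descFactorial (2 * a + b) ≤ partition n m q lam a b := by
  have h1 := le_buildOp (f := weight lam) (σ := init n) (l := 0) (j := 3 * n - (2 * a + b)) (a := a)
    (b := b) hm hq0 hq1 hθ0 hc hj (by simpa using hf) (by omega) (by
      convert init_valid n m using 1
      omega)
  rw [show 3 * n - (2 * a + b) + b + 2 * a = 3 * n by omega] at h1
  refine le_trans (le_of_eq ?_) h1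
  ring

theorem le_freeEnergy (hm : 2 ≤ m) (hq0 : 0 ≤ q) (hq1 : q ≤ 1) {j₀ : ℕ} {θ c : ℝ} (hθ0 : 0 < θ)
    (hc : 0 < c) (hj : ∀ i : ℕ, j₀ ≤ i → θ * (i + 1) ≤ i + 1 - 3 * 4 ^ m) {a b : ℕ}
    (hab : 2 * a + b + j₀ ≤ 3 * n)
    (hf : ∀ τ : PartialCubic n, τ.Valid m (3 * n - (2 * a + b)) b → c ≤ weight lam τ) :
    a * Real.log θ + Real.log c ≤ freeEnergy n m q lam a b := by
  have hD : (0 : ℝ) < (3 * n).descFactorial (2 * a + b) := descFactorial_pos (by omega)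
  rw [← Real.log_pow, ← Real.log_mul (by positivity) (by positivity)]
  refine Real.log_le_log (by positivity) ?_
  rw [le_div_iff₀ hD]
  exact le_partition hm hq0 hq1 hθ0.le hc.le hj hab hf

theorem freeEnergy_zero_le (hlam : 1 ≤ lam) (hq0 : 0 ≤ q) (hq1 : q ≤ 1) {b : ℕ}
    (hb : b ≤ 3 * n) (hpos : 0 < partition n m q lam 0 b) :
    freeEnergy n m q lam 0 b ≤ ((3 * n - b : ℕ) : ℝ) * Real.log lam +
      n * Real.log (1 + (lam - 1) * (1 - q) ^ 3) := by
  have hD : (0 : ℝ) < (3 * n).descFactorial b := descFactorial_pos hb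
  have h1 : 0 < 1 + (lam - 1) * (1 - q) ^ 3 := by
    have : 0 ≤ (lam - 1) * (1 - q) ^ 3 :=
      mul_nonneg (by linarith) (pow_nonneg (by linarith) 3)
    linarith
  have hlam0 : 0 < lam := by linarith
  rw [← Real.log_pow, ← Real.log_pow, ← Real.log_mul (by positivity) (by positivity), freeEnergy,
    mul_zero, zero_add]
  refine Real.log_le_log (by positivity) ?_
  rw [div_le_iff₀ hD]
  refine (partition_zero_le hlam hq0 hq1 hb).trans (le_of_eq ?_)
  ring

theorem freeEnergy_step (hm : 2 ≤ m) (hlam : 1 ≤ lam) (hq0 : 0 ≤ q) (hq1 : q < 1) {a b s : ℕ}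
    (hs : 2 ≤ s) (hab : 2 * a + b + s = 3 * n) (h1 : 0 < partition n m q lam a b)
    (h2 : 0 < partition n m q lam (a + 1) b) :
    freeEnergy n m q lam (a + 1) b + freeEnergy n m q lam a b ≤
      2 * freeEnergy n m q lam a (b + 1) - Real.log (1 - (1 - lam⁻¹) * q ^ 2) -
        Real.log (1 - (s : ℝ)⁻¹) := by
  have hD0 : (0 : ℝ) < (3 * n).descFactorial (2 * a + b) := descFactorial_pos (by omega)
  have hD1 : ((3 * n).descFactorial (2 * a + (b + 1)) : ℝ) =
      s * (3 * n).descFactorial (2 * a + b) := by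
    rw [← add_assoc, Nat.descFactorial_succ, show 3 * n - (2 * a + b) = s by omega]
    push_cast; ring
  have hD2 : ((3 * n).descFactorial (2 * (a + 1) + b) : ℝ) =
      (s - 1) * (s * (3 * n).descFactorial (2 * a + b)) := by
    rw [show 2 * (a + 1) + b = 2 * a + (b + 1) + 1 by ring, Nat.descFactorial_succ,
      show 3 * n - (2 * a + (b + 1)) = s - 1 by omega]
    push_cast [Nat.cast_sub (show 1 ≤ s by omega)]
    rw [hD1]
  have hs' : (2 : ℝ) ≤ s := by exact_mod_cast hs
  have hs1 : (0 : ℝ) < s - 1 := by linarith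
  have hs0 : (0 : ℝ) < s := by linarith
  have hcq : 0 < 1 - (1 - lam⁻¹) * q ^ 2 := by
    have hi : 0 < lam⁻¹ := by positivity
    have hi1 : lam⁻¹ ≤ 1 := inv_le_one_of_one_le₀ hlam
    have hq2 : q ^ 2 < 1 := pow_lt_one₀ hq0 hq1 (by norm_num)
    nlinarith [sq_nonneg q]
  have hsinv : 0 < 1 - (s : ℝ)⁻¹ := by
    rw [sub_pos]; exact inv_lt_one_of_one_lt₀ (by linarith)
  have hmain := partition_mul_partition_le hm hlam hq0 hq1.le (by omega : 2 * a + b < 3 * n) h1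
  simp only [freeEnergy]
  rw [hD1, hD2]
  set D := ((3 * n).descFactorial (2 * a + b) : ℝ)
  -- The factor `1 - s⁻¹` compares the normalisations: two half-edges are drawn without replacement
  -- on the left, `s (s - 1)`, against `s²` on the right.
  have key : Real.log (partition n m q lam (a + 1) b / ((s - 1) * (s * D)) *
      (partition n m q lam a b / D) * (1 - (1 - lam⁻¹) * q ^ 2) * (1 - (s : ℝ)⁻¹)) ≤
      Real.log ((partition n m q lam a (b + 1) / (s * D)) ^ 2) := by
    refine Real.log_le_log (by positivity) ?_
    have e1 : partition n m q lam (a + 1) b / ((s - 1) * (s * D)) *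
        (partition n m q lam a b / D) * (1 - (1 - lam⁻¹) * q ^ 2) * (1 - (s : ℝ)⁻¹) =
        (partition n m q lam (a + 1) b * partition n m q lam a b * (1 - (1 - lam⁻¹) * q ^ 2)) /
          (s * D) ^ 2 := by
      rw [show 1 - (s : ℝ)⁻¹ = (s - 1) / s by field_simp]
      field_simp
    rw [e1, div_pow]
    gcongr
  rw [Real.log_mul (by positivity) hsinv.ne', Real.log_mul (by positivity) hcq.ne',
    Real.log_mul (by positivity) (by positivity), Real.log_pow] at key
  push_cast at key
  linarith

/-- A lower bound for the independence number of the cubic graphs without short cycles bounds the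
weights of the partially built ones from below. -/
theorem Valid.le_two_mul_indepNum (hm : 2 ≤ m) (hn : 2 * 4 ^ (m + 1) < n) (heven : Even n) {A : ℝ}
    (hA : ∀ H : SimpleGraph (Fin n), LocallyFar m H → (∀ i, valency H i = 3) → A ≤ H.indepNum)
    {j : ℕ} {τ : PartialCubic n} (hτ : τ.Valid m j 0) :
    A - j / 2 ≤ indepNumOff τ.graph τ.deleted := by
  obtain ⟨H, hH, hH3, hi⟩ := hτ.locallyFar.exists_cubic hm (by simpa using hn) (by simpa using heven)
    j hτ.valency_le (by simpa using hτ.le_sum)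
  have h1 := hA H hH hH3
  have h2 : τ.deleted = ∅ := Finset.card_eq_zero.1 (Nat.le_zero.1 hτ.card_deleted)
  have h3 := indepNum_le_indepNumOff_empty (G := τ.graph)
  rw [h2]
  have h4 : 2 * H.indepNum ≤ 2 * indepNumOff τ.graph ∅ + j := by omega
  have h5 : (2 : ℝ) * H.indepNum ≤ 2 * indepNumOff τ.graph ∅ + j := by exact_mod_cast h4
  linarith

end PartialCubic

/-! ### Choice of parameters and the contradiction -/

theorem neg_two_mul_le_log_one_sub {x : ℝ} (hx0 : 0 ≤ x) (hx : x ≤ 1 / 2) :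
    -(2 * x) ≤ Real.log (1 - x) := by
  refine le_trans ?_ (Real.one_sub_inv_le_log_of_pos (by linarith : 0 < 1 - x))
  rw [le_sub_iff_add_le, ← le_sub_iff_add_le', inv_le_comm₀ (by linarith) (by linarith)]
  rw [inv_le_comm₀ (by linarith) (by linarith)]
  rw [inv_le_iff_one_le_mul₀ (by linarith)]
  nlinarith

/-- The replica bound at `lam = 8` and `q = 3 / 5`. -/
theorem replica_bound_numeric :
    2 * Real.log (181 / 125) - 3 * Real.log (137 / 200) ≤ 19 / 21 * Real.log 8 := by
  have h8 : Real.log 8 = 3 * Real.log 2 := by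
    rw [show (8 : ℝ) = 2 ^ 3 by norm_num, Real.log_pow]; norm_num
  -- Multiplying by seven clears the denominator, because `log 8 = 3 log 2`, and leaves a comparison
  -- of rational numbers.
  have h : Real.log ((181 / 125 : ℝ) ^ 14) ≤ Real.log (2 ^ 19 * (137 / 200 : ℝ) ^ 21) :=
    Real.log_le_log (by positivity) (by norm_num)
  rw [Real.log_mul (by positivity) (by positivity), Real.log_pow, Real.log_pow, Real.log_pow] at h
  push_cast at h
  rw [h8]
  linarith

open PartialCubic in
/-- There are cubic graphs without short cycles whose independence ratio is at most `0.454`. -/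
theorem exists_cubic_indepNum_le {m : ℕ} (hm : 2 ≤ m) :
    ∃ (n : ℕ) (H : SimpleGraph (Fin n)), 0 < n ∧ LocallyFar m H ∧ (∀ i, valency H i = 3) ∧
      (H.indepNum : ℝ) ≤ 0.454 * n := by
  by_contra! hcon
  -- At least `w` of the `12000 * w` half-edges always stay free. The three summands outweigh the
  -- errors in the final comparison: the quadratic term, the near pairs, and the normalisation.
  obtain ⟨w, hw⟩ : ∃ w : ℕ, w = 24000000 + 36000 * 4 ^ m + 12000 := ⟨_, rfl⟩
  obtain ⟨n, hn⟩ : ∃ n : ℕ, n = 4000 * w := ⟨_, rfl⟩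
  have hw4 : 6 * 4 ^ m ≤ w := by omega
  have hnbig : 2 * 4 ^ (m + 1) < n := by rw [pow_succ]; omega
  have heven : Even n := ⟨2000 * w, by omega⟩
  have hw0 : (0 : ℝ) < w := by exact_mod_cast (by omega : 0 < w)
  have hwR : (w : ℝ) = 24000000 + 36000 * 4 ^ m + 12000 := by rw [hw]; push_cast; ring
  have hnR : (n : ℝ) = 4000 * w := by rw [hn]; push_cast; ring
  have hlog1 : 1 ≤ Real.log 8 := by
    rw [Real.le_log_iff_exp_le (by norm_num)]
    linarith [Real.exp_one_lt_d9]
  set Λ := Real.log 8 with hΛ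
  -- A bound for the fraction of partners that are too near.
  set K : ℝ := 3 * 4 ^ m / w with hK
  have hKw : K * w = 3 * 4 ^ m := by rw [hK]; field_simp
  have hK0 : 0 ≤ K := by positivity
  have hK1 : K ≤ 1 / 2 := by
    rw [hK, div_le_iff₀ hw0]
    have : (6 * 4 ^ m : ℝ) ≤ w := by exact_mod_cast hw4
    linarith
  have hθ : ∀ i : ℕ, w ≤ i → (1 - K) * (i + 1) ≤ i + 1 - 3 * 4 ^ m := by
    intro i hi
    have h1 : (w : ℝ) ≤ i := by exact_mod_cast hi
    have h2 := mul_le_mul_of_nonneg_left h1 hK0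
    linarith
  have hθlog := neg_two_mul_le_log_one_sub hK0 hK1
  have hθa : ∀ a : ℕ, 2 * a + w ≤ 3 * n → -(36000 * 4 ^ m : ℝ) ≤ a * Real.log (1 - K) := by
    intro a ha
    have h1 : (a : ℝ) ≤ 6000 * w := by exact_mod_cast (by omega : a ≤ 6000 * w)
    have h2 := mul_le_mul_of_nonneg_left hθlog (Nat.cast_nonneg (α := ℝ) a)
    have h3 := mul_le_mul_of_nonneg_left h1 hK0
    linarith
  have hpart : ∀ a b : ℕ, 2 * a + b + w ≤ 3 * n → 0 < partition n m (3 / 5) 8 a b := by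
    intro a b hab
    have h1 := le_partition (lam := 8) hm (by norm_num : (0 : ℝ) ≤ 3 / 5) (by norm_num)
      (by linarith : 0 ≤ 1 - K) zero_le_one hθ hab fun τ _ => one_le_weight (by norm_num)
    refine lt_of_lt_of_le ?_ h1
    have h2 := descFactorial_pos (by omega : 2 * a + b ≤ 3 * n)
    have h3 : 0 < 1 - K := by linarith
    positivity
  set κ : ℝ := -Real.log (137 / 200) / 2 + (w : ℝ)⁻¹ with hκ
  have hlogneg : Real.log (137 / 200) ≤ 0 := Real.log_nonpos (by norm_num) (by norm_num)
  -- At `N` there are `w` free half-edges, at `M` there are `2 * w`. Completing costs half of these,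
  -- so the exponent at `M` is `0.454 n - w = 1815 w`, with slope `1 / 2`. The choice of `r` works
  -- at the frontier because `1815 + 1 / 2 ≤ 2000`, and `C` is the total loss from near pairs.
  have hmain := quadratic_le_of_average_le (g := freeEnergy n m (3 / 5) 8) (N := 11999 * w)
    (M := 11998 * w) (w := w) (p := 1815 * w * Λ - 36000 * 4 ^ m) (t := Λ / 2) (r := 2000 * Λ / w)
    (κ := κ) (C := 36000 * 4 ^ m) (by positivity)
    (add_nonneg (div_nonneg (neg_nonneg.2 hlogneg) (by norm_num)) (by positivity)) ?_ ?_ ?_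
    (by push_cast; ring) ?_ 0 (11998 * w) (by omega)
  · have hend := freeEnergy_zero_le (n := n) (m := m) (lam := 8) (by norm_num)
      (by norm_num : (0 : ℝ) ≤ 3 / 5) (by norm_num) (b := 11998 * w) (by omega)
      (hpart 0 (11998 * w) (by omega))
    rw [show 3 * n - 11998 * w = 2 * w by omega, ← hΛ, hnR,
      show (1 : ℝ) + (8 - 1) * (1 - 3 / 5) ^ 3 = 181 / 125 by norm_num] at hend
    have hall := hmain.trans hend
    push_cast at hall
    simp only [mul_zero, zero_add, sub_self] at hall
    have h1 : 2000 * Λ / w * (0 ^ 2 + 11998 * (w : ℝ)) = 23996000 * Λ := by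
      field_simp
      ring
    have h2 : 11998 * (w : ℝ) * κ = -(5999 * w * Real.log (137 / 200)) + 11998 := by
      rw [hκ]; field_simp; ring
    rw [h1, h2] at hall
    -- The margin is `1815 - 2 - 2000 * 19 / 21 > 3` in units of `w * Λ`.
    have h3 := mul_le_mul_of_nonneg_left replica_bound_numeric (by positivity : 0 ≤ 2000 * (w : ℝ))
    rw [← hΛ] at h3
    have h4 : 0 ≤ -((w : ℝ) * Real.log (137 / 200)) := by
      rw [neg_nonneg]
      exact mul_nonpos_of_nonneg_of_nonpos hw0.le hlogneg
    have h5 : (3 * (w : ℝ) - 23996000) * Λ ≤ 36000 * 4 ^ m + 11998 := by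
      have : 0 ≤ (w : ℝ) * Λ := by positivity
      linarith
    have h6 : (0 : ℝ) ≤ 4 ^ m := by positivity
    have h7 : 3 * (w : ℝ) - 23996000 ≤ (3 * (w : ℝ) - 23996000) * Λ :=
      le_mul_of_one_le_right (by linarith) hlog1
    linarith
  · intro k l hkl
    obtain ⟨s, hs⟩ := Nat.exists_eq_add_of_le (by omega : 2 * k + l ≤ 3 * n)
    have hsw : w + 2 ≤ s := by omega
    have h1 := freeEnergy_step (lam := 8) (s := s) hm (by norm_num) (by norm_num : (0 : ℝ) ≤ 3 / 5)
      (by norm_num) (by omega) hs.symm (hpart k l (by omega)) (hpart (k + 1) l (by omega))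
    rw [show (1 : ℝ) - (1 - 8⁻¹) * (3 / 5) ^ 2 = 137 / 200 by norm_num] at h1
    have hsR : (w : ℝ) ≤ s := by exact_mod_cast (by omega : w ≤ s)
    have h2 : (s : ℝ)⁻¹ ≤ (w : ℝ)⁻¹ := inv_anti₀ hw0 hsR
    have h3 : (s : ℝ)⁻¹ ≤ 1 / 2 := by
      rw [one_div]
      exact inv_anti₀ (by norm_num) (by exact_mod_cast (by omega : 2 ≤ s))
    have h4 := neg_two_mul_le_log_one_sub (by positivity) h3
    rw [hκ]
    linarith
  · intro k l hkl
    have h1 := le_freeEnergy (lam := 8) hm (by norm_num : (0 : ℝ) ≤ 3 / 5) (by norm_num)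
      (by linarith : 0 < 1 - K) zero_lt_one hθ (by omega : 2 * k + l + w ≤ 3 * n)
      fun τ _ => one_le_weight (by norm_num)
    rw [Real.log_one, add_zero] at h1
    exact (hθa k (by omega)).trans h1
  · intro k hk
    have hA : ∀ H : SimpleGraph (Fin n), LocallyFar m H → (∀ i, valency H i = 3) →
        (0.454 * n : ℝ) ≤ H.indepNum := fun H hH hH3 => (hcon n H (by omega) hH hH3).le
    have h1 := le_freeEnergy (lam := 8) (a := k) (b := 0)
      (c := (8 : ℝ) ^ ((1815 * w + (2 * k - 11998 * w) / 2 : ℝ))) hm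
      (by norm_num : (0 : ℝ) ≤ 3 / 5) (by norm_num) (by linarith : 0 < 1 - K) (by positivity) hθ
      (by omega : 2 * k + 0 + w ≤ 3 * n) fun τ hτ => by
        have h2 := hτ.le_two_mul_indepNum hm hnbig heven hA
        rw [weight, ← Real.rpow_natCast]
        refine Real.rpow_le_rpow_of_exponent_le (by norm_num) (le_trans (le_of_eq ?_) h2)
        rw [Nat.cast_sub (by omega)]
        push_cast
        rw [hnR]
        ring
    rw [Real.log_rpow (by norm_num), ← hΛ] at h1
    have h2 := hθa k (by omega)
    linarith
  · have h1 : 2000 * Λ / w * (w : ℝ) ^ 2 = 2000 * (w * Λ) := by field_simp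
    rw [h1]
    have : 0 ≤ (w : ℝ) * Λ := by positivity
    linarith

/-! ### Existence of the limit -/

theorem exists_mem_regularGirthRatios_le (g : ℕ) : ∃ ρ ∈ regularGirthRatios 3 g, ρ ≤ 0.454 := by
  obtain ⟨n, H, hn, hH, hH3, hi⟩ := exists_cubic_indepNum_le (m := g + 2) (by omega)
  obtain ⟨k, G, hk, hG, hgirth, hρ⟩ := indepRatio_mem_regularGirthRatios hn hH hH3
  refine ⟨indepRatio H, ⟨k, G, hk, hG, le_trans ?_ hgirth, hρ⟩, ?_⟩
  · exact_mod_cast Nat.le_add_right g 2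
  · rw [indepRatio, div_le_iff₀ (by exact_mod_cast hn)]
    exact hi

theorem regularGirthRatios_bddBelow (r g : ℕ) : BddBelow (regularGirthRatios r g) := by
  refine ⟨0, ?_⟩
  rintro _ ⟨n, G, -, -, -, rfl⟩
  exact div_nonneg (Nat.cast_nonneg _) (Nat.cast_nonneg _)

theorem regularGirthRatios_anti (r : ℕ) : Antitone (regularGirthRatios r) := by
  rintro g h hgh _ ⟨n, G, hn, hG, hgirth, rfl⟩
  exact ⟨n, G, hn, hG, le_trans (by exact_mod_cast hgh) hgirth, rfl⟩

/-- Cubic graphs of every girth exist (so that each `i(3, g)` is an infimum over a non-empty set),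
the limit `i(3, ∞)` of `i(3, g)` as `g → ∞` exists, and it is at most `0.454`. -/
theorem theorem2 :
    (∀ g : ℕ, (regularGirthRatios 3 g).Nonempty) ∧
      ∃ L : ℝ, Tendsto (fun g : ℕ => infIndepRatio 3 g) atTop (𝓝 L) ∧ L ≤ (0.454 : ℝ) := by
  have hne : ∀ g : ℕ, (regularGirthRatios 3 g).Nonempty := fun g =>
    let ⟨ρ, hρ, _⟩ := exists_mem_regularGirthRatios_le g
    ⟨ρ, hρ⟩
  have hle : ∀ g : ℕ, infIndepRatio 3 g ≤ 0.454 := fun g =>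
    let ⟨_, hρ, hρ'⟩ := exists_mem_regularGirthRatios_le g
    (csInf_le (regularGirthRatios_bddBelow 3 g) hρ).trans hρ'
  -- Non-emptiness matters here: the real `sInf` of the empty set is `0`.
  have hmono : Monotone fun g : ℕ => infIndepRatio 3 g := fun g h hgh =>
    csInf_le_csInf (regularGirthRatios_bddBelow 3 g) (hne h) (regularGirthRatios_anti 3 hgh)
  exact ⟨hne, _, tendsto_atTop_ciSup hmono ⟨0.454, Set.forall_mem_range.2 hle⟩, ciSup_le hle⟩
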